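/- Let $N$ be a square-free positive integer with an odd number of prime factors, and let $D=\left(\frac{a,b}{\mathbb{Q}}\right)$ (with $a,b\in\mathbb{Q}^\times$; basis $1,i,j,k$, $i^2=a$, $j^2=b$, $ij=-ji=k$) be the definite quaternion algebra over $\mathbb{Q}$ of discriminant $N$; that is, $D\otimes_{\mathbb{Q}}\mathbb{R}\not\cong M_2(\mathbb{R})$, and for every prime $p$ one has $D\otimes_{\mathbb{Q}}\mathbb{Q}_p\not\cong M_2(\mathbb{Q}_p)$ if and only if $p\mid N$. Let $\mathrm{Tr}_D$ and $N_D$ denote the reduced trace and the reduced norm of $D$. (1) There is an $x\in D$ with $\mathrm{Tr}_D(x)=0$ and $N_D(x)=1$ if and only if $N$ has no prime factor $p\equiv 1\pmod 4$. (2) There is an $x\in D$ with $\mathrm{Tr}_D(x)=1$ and $N_D(x)=1$ if and only if $N$ has no prime factor $p\equiv 1\pmod 3$. -/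

import Mathlib

open scoped Quaternion TensorProduct

namespace QuatAlg

/-- The quaternion algebra `(a, b / F)`: the `F`-algebra with basis `1, i, j, k`, where
`i ^ 2 = a`, `j ^ 2 = b` and `i * j = -(j * i) = k`. (For `a, b ≠ 0` and `2 ≠ 0` in the field `F`.) -/
abbrev Quat (F : Type*) [Field F] (a b : F) : Type _ := QuaternionAlgebra F a 0 b

variable {F : Type*} [Field F] {a b : F}

/-- The reduced trace `x + x̄`, an element of `F`; here `star` is the standard involution. -/
def reducedTrace (x : Quat F a b) : F := (x + star x).re

/-- The reduced norm `x * x̄`, an element of `F`. -/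
def reducedNorm (x : Quat F a b) : F := (x * star x).re

/-- The quaternion algebra `(a, b / F)` splits over the extension field `K` of `F`:
its base change to `K` is isomorphic to the algebra of `2 × 2` matrices over `K`. -/
def SplitOver (a b : F) (K : Type*) [Field K] [Algebra F K] : Prop :=
  Nonempty ((K ⊗[F] Quat F a b) ≃ₐ[K] Matrix (Fin 2) (Fin 2) K)

/-- A quaternion algebra over `ℚ` is definite if it is ramified at the infinite place,
that is, if it does not split over `ℝ`. -/
def IsDefinite (a b : ℚ) : Prop := ¬ SplitOver a b ℝ

/-- The quaternion algebra `(a, b / ℚ)` is ramified at the prime `p` if it does not split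
over `ℚ_[p]`. -/
def RamifiedAt (a b : ℚ) (p : ℕ) [Fact p.Prime] : Prop := ¬ SplitOver a b ℚ_[p]

/-- For a square-free positive integer `N`: the quaternion algebra `(a, b / ℚ)` has discriminant
`N`, the discriminant being the product of the primes at which the algebra is ramified. In other
words, the primes at which it is ramified are precisely the prime divisors of `N`. -/
def HasDiscriminant (a b : ℚ) (N : ℕ) : Prop :=
  ∀ (p : ℕ) [Fact p.Prime], RamifiedAt a b p ↔ p ∣ N

end QuatAlg

/-! An element of trace 0 and norm 1 is a pure quaternion with square -1; an element of trace 1 and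
norm 1 is 1/2 plus a pure quaternion whose double has square -3. With d = 1 or 3, the question is
thus whether -d is the square of a pure quaternion. If it is, and -d is a square in ℚ_p, then D
splits at p (`of_pure_eq_sq`); so -d is a non-square at every ramified p. For odd p, -1 is a square
in ℚ_p iff p ≡ 1 mod 4, and -3 iff p ≡ 1 mod 3; the prime 2 satisfies neither congruence.

The converse, `isPureSquare_rat`, amounts to the Hasse principle for the form ⟨a, b, -ab, d⟩. It
suffices to find a rational t such that bt is a norm from ℚ(√a) and t is a norm from ℚ(√(-ad))
(`IsPureSquare.of_common_slot`). Such a t exists over ℚ_p for odd p (`exists_common_slot_padic`).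
Dirichlet's theorem gives one integer t that serves at all odd primes dividing 3ab, at the cost of
one new prime l dividing t; l is chosen so that a and -ad are squares in ℚ_l. Legendre's theorem
(`isNormValue_of_forall_padic`), which does not involve the place 2, then makes t work over ℚ.

The symbol (a/l) can be adjusted through l mod 8 when a is -2 times an odd number up to squares. A
change of quaternion basis reduces every definite algebra to this case. -/

namespace QuatAlg

/-- The element `b` is a value of the norm form `x ^ 2 - a * y ^ 2`. For `a, b ≠ 0` in a field of
characteristic not two, this says that the Hilbert symbol of `a` and `b` is trivial. -/
def IsNormValue {K : Type*} [Field K] (a b : K) : Prop := ∃ x y : K, b = x ^ 2 - a * y ^ 2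

/-! ### Calculus of norm values (trivial Hilbert symbols) over a field. -/

section NormValue

variable {K : Type*} [Field K] {a b c : K}

namespace IsNormValue

theorem sq (a c : K) : IsNormValue a (c ^ 2) := ⟨c, 0, by ring⟩

theorem one (a : K) : IsNormValue a 1 := ⟨1, 0, by ring⟩

theorem neg_self (a : K) : IsNormValue a (-a) := ⟨0, 1, by ring⟩

theorem mul (hb : IsNormValue a b) (hc : IsNormValue a c) : IsNormValue a (b * c) := by
  obtain ⟨x, y, rfl⟩ := hb
  obtain ⟨z, w, rfl⟩ := hc
  exact ⟨x * z + a * y * w, x * w + y * z, by ring⟩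

theorem of_mul_sq (hc : c ≠ 0) (h : IsNormValue a (b * c ^ 2)) : IsNormValue a b := by
  obtain ⟨x, y, h⟩ := h
  refine ⟨x / c, y / c, ?_⟩
  field_simp
  linear_combination h

theorem of_mul (hc : c ≠ 0) (h : IsNormValue a (b * c)) (h' : IsNormValue a c) :
    IsNormValue a b :=
  of_mul_sq hc (by convert h.mul h' using 1; ring)

theorem of_isSquare_right (hb : IsSquare b) : IsNormValue a b := by
  obtain ⟨c, rfl⟩ := hb
  exact ⟨c, 0, by ring⟩

theorem of_isSquare_left (h2 : (2 : K) ≠ 0) (ha : a ≠ 0) (h : IsSquare a) (b : K) :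
    IsNormValue a b := by
  obtain ⟨c, rfl⟩ := h
  have hc : c ≠ 0 := fun h => ha (by simp [h])
  refine ⟨(b + 1) / 2, (b - 1) / (2 * c), ?_⟩
  field_simp
  ring

theorem symm (h2 : (2 : K) ≠ 0) (hb : b ≠ 0) (h : IsNormValue a b) :
    IsNormValue b a := by
  obtain ⟨x, y, h⟩ := h
  by_cases hy : y = 0
  · subst hy
    exact of_isSquare_left h2 hb ⟨x, by rw [h]; ring⟩ a
  · refine ⟨x / y, 1 / y, ?_⟩
    field_simp
    linear_combination h

theorem mul_sq_left (hc : c ≠ 0) (h : IsNormValue a b) : IsNormValue (a * c ^ 2) b := by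
  obtain ⟨x, y, h⟩ := h
  refine ⟨x, y / c, ?_⟩
  field_simp
  exact h

theorem of_mul_sq_left (h : IsNormValue (a * c ^ 2) b) : IsNormValue a b := by
  obtain ⟨x, y, h⟩ := h
  exact ⟨x, y * c, by rw [h]; ring⟩

theorem mul_sq (h : IsNormValue a b) (c : K) : IsNormValue a (b * c ^ 2) := h.mul (sq a c)

theorem neg_mul (h : IsNormValue a b) : IsNormValue a (-(a * b)) := by
  simpa using (neg_self a).mul h

/-- The elements i + j and k anticommute and have squares a + b and -ab, so both pairs of slots
describe the same algebra. -/
theorem add_neg_mul (h2 : (2 : K) ≠ 0) (ha : a ≠ 0) (hb : b ≠ 0) (hab : a + b ≠ 0)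
    (h : IsNormValue a b) : IsNormValue (a + b) (-(a * b)) := by
  have hn : -(a * b) ≠ 0 := neg_ne_zero.mpr (mul_ne_zero ha hb)
  refine symm h2 hab (of_mul ha (c := a) ⟨a, 1, by ring⟩ (symm h2 hn h.neg_mul))

/-- If a nonzero square of `K` is the square of a pure quaternion, then `(a, b / K)` is split. -/
theorem of_pure_eq_sq (h2 : (2 : K) ≠ 0) (ha : a ≠ 0) {x y z s : K} (hs : s ≠ 0)
    (h : a * x ^ 2 + b * y ^ 2 - a * b * z ^ 2 = s ^ 2) : IsNormValue a b := by
  by_cases h0 : y ^ 2 - a * z ^ 2 = 0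
  · have hx : x ≠ 0 := by
      rintro rfl
      exact hs (pow_eq_zero_iff two_ne_zero |>.mp (by linear_combination -h + b * h0))
    refine of_isSquare_left h2 ha ⟨s / x, ?_⟩ b
    field_simp
    linear_combination h - b * h0
  · exact of_mul h0 (c := y ^ 2 - a * z ^ 2) ⟨s, x, by linear_combination h⟩ ⟨y, z, rfl⟩

end IsNormValue

end NormValue

/-! ### Splitting of a quaternion algebra as a norm condition. -/

section Split

variable {F : Type*} [Field F] {a b : F} {K : Type*} [Field K] [Algebra F K]

theorem IsNormValue.of_matrix (h2 : (2 : K) ≠ 0) {a b : K} (ha : a ≠ 0)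
    {I J : Matrix (Fin 2) (Fin 2) K} (hI : I * I = a • 1) (hJ : J * J = b • 1)
    (hIJ : J * I = -(I * J)) : IsNormValue a b := by
  have e := fun i j => congrFun (congrFun hI i) j
  have f := fun i j => congrFun (congrFun hJ i) j
  have g := fun i j => congrFun (congrFun hIJ i) j
  simp only [Matrix.mul_apply, Fin.sum_univ_two, Matrix.smul_apply, Matrix.neg_apply,
    smul_eq_mul] at e f g
  have e00 := e 0 0
  have f00 := f 0 0
  have g00 := g 0 0
  simp only [Matrix.one_apply_eq, mul_one] at e00 f00
  by_cases hr : I 1 0 = 0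
  · refine .of_isSquare_left h2 ha ⟨I 0 0, ?_⟩ b
    rw [hr] at e00
    linear_combination -e00
  -- With y = J₁₀/I₁₀ the matrix J - yI is upper triangular, and its square is the scalar b + ay²
  -- because I and J anticommute; x is its upper left entry.
  · refine ⟨J 0 0 - J 1 0 / I 1 0 * I 0 0, J 1 0 / I 1 0, ?_⟩
    field_simp
    linear_combination (-I 1 0 ^ 2) * f00 - J 1 0 ^ 2 * e00 + I 1 0 * J 1 0 * g00

theorem splitOver_iff_isNormValue (h2 : (2 : K) ≠ 0) (ha : a ≠ 0) (hb : b ≠ 0) :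
    SplitOver a b K ↔ IsNormValue (algebraMap F K a) (algebraMap F K b) := by
  have ha' : algebraMap F K a ≠ 0 := by simpa using ha
  have hb' : algebraMap F K b ≠ 0 := by simpa using hb
  constructor
  · rintro ⟨e⟩
    let f : Quat F a b →ₐ[F] Matrix (Fin 2) (Fin 2) K :=
      (e.toAlgHom.restrictScalars F).comp Algebra.TensorProduct.includeRight
    let q := (QuaternionAlgebra.Basis.self F (c₁ := a) (c₂ := 0) (c₃ := b)).compHom f
    refine .of_matrix h2 ha' (I := q.i) (J := q.j) ?_ ?_ ?_
    · rw [q.i_mul_i]; simp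
    · rw [q.j_mul_j]; simp
    · rw [q.j_mul_i, q.i_mul_j]; simp
  · rintro ⟨x, y, h⟩
    set A := algebraMap F K a
    set B := algebraMap F K b
    have hs : ∀ (c : F) (r : K), c • r = algebraMap F K c * r := Algebra.smul_def
    let q : QuaternionAlgebra.Basis (Matrix (Fin 2) (Fin 2) K) a 0 b :=
      { i := !![0, A; 1, 0]
        j := !![x, -(A * y); y, -x]
        k := !![A * y, -(A * x); x, -(A * y)]
        i_mul_i := by
          ext i j; fin_cases i <;> fin_cases j <;> simp [Matrix.mul_apply, A, hs]
        j_mul_j := by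
          ext i j
          fin_cases i <;> fin_cases j <;>
            simp [Matrix.mul_apply, hs] <;>
            first | ring1 | (change _ = B; rw [h]; ring1)
        i_mul_j := by
          ext i j; fin_cases i <;> fin_cases j <;> simp [Matrix.mul_apply]
        j_mul_i := by
          ext i j; fin_cases i <;> fin_cases j <;> simp [Matrix.mul_apply] <;> ring }
    let φ : K ⊗[F] Quat F a b →ₐ[K] Matrix (Fin 2) (Fin 2) K :=
      Algebra.TensorProduct.lift (Algebra.ofId K _) q.liftHom
        (fun r s => Algebra.commutes r _)
    have hφ : ∀ (c : K) (z : Quat F a b), φ (c ⊗ₜ z) = c • q.lift z := fun c z => by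
      simp [φ, Algebra.smul_def]; rfl
    have hsurj : Function.Surjective φ := by
      intro M
      have hB : B ≠ 0 := hb'
      have hA : A ≠ 0 := ha'
      let s := (M 0 0 - M 1 1) / 2
      let r := (M 1 0 - M 0 1 / A) / 2
      -- Cramer's rule for the system `h₁`, `h₂`, whose determinant is x² - Ay² = B.
      let β := (x * s - A * y * r) / B
      let γ := (x * r - y * s) / B
      have h₁ : β * x + γ * (A * y) = s := by
        simp only [β, γ]
        field_simp
        linear_combination (-s) * h
      have h₂ : β * y + γ * x = r := by
        simp only [β, γ]
        field_simp
        linear_combination (-r) * h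
      let δ := (M 0 0 + M 1 1) / 2
      let ε := (M 1 0 + M 0 1 / A) / 2
      have h₃ : M 0 0 = δ + s := by simp only [s, δ]; field_simp; ring
      have h₄ : M 1 1 = δ - s := by simp only [s, δ]; field_simp; ring
      have h₅ : M 1 0 = ε + r := by simp only [r, ε]; field_simp; ring
      have h₆ : M 0 1 = A * (ε - r) := by simp only [r, ε]; field_simp; ring
      refine ⟨δ ⊗ₜ 1 + ε ⊗ₜ ⟨0, 1, 0, 0⟩ + β ⊗ₜ ⟨0, 0, 1, 0⟩ + γ ⊗ₜ ⟨0, 0, 0, 1⟩, ?_⟩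
      simp only [map_add, hφ, QuaternionAlgebra.Basis.lift]
      clear_value β γ δ ε s r
      ext i j
      fin_cases i <;> fin_cases j <;> simp [q]
      · linear_combination h₁ - h₃
      · linear_combination -A * h₂ - h₆
      · linear_combination h₂ - h₅
      · linear_combination -h₁ - h₄
    have hfin : Module.finrank K (K ⊗[F] Quat F a b)
        = Module.finrank K (Matrix (Fin 2) (Fin 2) K) := by
      rw [Module.finrank_baseChange, QuaternionAlgebra.finrank_eq_four, Module.finrank_matrix]
      simp
    have hinj : Function.Injective φ :=
      (LinearMap.injective_iff_surjective_of_finrank_eq_finrank (f := φ.toLinearMap) hfin).mpr hsurj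
    exact ⟨AlgEquiv.ofBijective φ ⟨hinj, hsurj⟩⟩

end Split

/-! ### Squares and norm values over ℚ_p for odd p. -/

section Local

variable {p : ℕ} [hp : Fact p.Prime]

theorem two_ne_zero_padic : (2 : ℚ_[p]) ≠ 0 := by
  exact_mod_cast (two_ne_zero : (2 : ℚ) ≠ 0)

theorem isSquare_of_norm_sub_one_lt_one (hp2 : p ≠ 2) {z : ℤ_[p]} (hz : ‖z - 1‖ < 1) :
    IsSquare z := by
  have h2 : ‖(2 : ℤ_[p])‖ = 1 := by
    have h := (PadicInt.norm_int_lt_one_iff_dvd (p := p) 2).not.mpr (fun h =>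
      hp2 ((Nat.prime_dvd_prime_iff_eq hp.out Nat.prime_two).mp (by exact_mod_cast h)))
    exact le_antisymm (PadicInt.norm_le_one _) (by simpa using h)
  obtain ⟨w, hw, -⟩ := hensels_lemma (p := p) (R := ℤ_[p])
    (F := Polynomial.X ^ 2 - Polynomial.C z) (a := 1)
    (by simpa [Polynomial.aeval_def, norm_sub_rev, one_add_one_eq_two, h2] using hz)
  exact ⟨w, by
    have : w ^ 2 - z = 0 := by simpa using hw
    linear_combination -this⟩

theorem toZMod_eq_iff_norm_sub_lt_one {x y : ℤ_[p]} :
    PadicInt.toZMod x = PadicInt.toZMod y ↔ ‖x - y‖ < 1 := by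
  rw [← sub_eq_zero, ← map_sub, ← RingHom.mem_ker, PadicInt.ker_toZMod,
    IsLocalRing.mem_maximalIdeal, PadicInt.mem_nonunits]

theorem toZMod_unit_ne_zero (u : ℤ_[p]ˣ) : PadicInt.toZMod (u : ℤ_[p]) ≠ 0 :=
  (u.isUnit.map PadicInt.toZMod).ne_zero

theorem isSquare_mul_of_toZMod_eq (hp2 : p ≠ 2) (u : ℤ_[p]ˣ) {v : ℤ_[p]}
    (h : PadicInt.toZMod v = PadicInt.toZMod (u : ℤ_[p])) : ∃ w : ℤ_[p], v = u * w ^ 2 := by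
  have h1 : ‖(↑u⁻¹ : ℤ_[p]) * v - 1‖ < 1 := by
    rw [← toZMod_eq_iff_norm_sub_lt_one, map_mul, h, ← map_mul]
    simp
  obtain ⟨w, hw⟩ := isSquare_of_norm_sub_one_lt_one hp2 h1
  exact ⟨w, by rw [sq, ← hw]; simp⟩

theorem isSquare_unit_of_toZMod (hp2 : p ≠ 2) (u : ℤ_[p]ˣ)
    (h : IsSquare (PadicInt.toZMod (u : ℤ_[p]))) : IsSquare (u : ℤ_[p]) := by
  obtain ⟨r, hr⟩ := h
  obtain ⟨x, rfl⟩ := ZMod.ringHom_surjective (PadicInt.toZMod (p := p)) r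
  have hx : IsUnit x := by
    rw [PadicInt.isUnit_iff]
    refine le_antisymm (PadicInt.norm_le_one x) (not_lt.mp fun hlt => ?_)
    have : PadicInt.toZMod x = PadicInt.toZMod 0 :=
      toZMod_eq_iff_norm_sub_lt_one.mpr (by simpa using hlt)
    exact toZMod_unit_ne_zero u (by rw [hr, this]; simp)
  obtain ⟨x, rfl⟩ := hx
  obtain ⟨w, hw⟩ := isSquare_mul_of_toZMod_eq hp2 (x * x) (v := u) (by simp [hr])
  exact ⟨x * w, by rw [hw]; push_cast; ring⟩

theorem coe_unit_ne_zero (u : ℤ_[p]ˣ) : ((u : ℤ_[p]) : ℚ_[p]) ≠ 0 := by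
  simp [PadicInt.coe_eq_zero]

theorem isSquare_coe {x : ℤ_[p]} (h : IsSquare x) : IsSquare (x : ℚ_[p]) :=
  h.map PadicInt.Coe.ringHom

theorem isSquare_coe_mul_of_not_isSquare (hp2 : p ≠ 2) {u v : ℤ_[p]ˣ}
    (hu : ¬ IsSquare ((u : ℤ_[p]) : ℚ_[p])) (hv : ¬ IsSquare ((v : ℤ_[p]) : ℚ_[p])) :
    IsSquare (((u : ℤ_[p]) : ℚ_[p]) * ((v : ℤ_[p]) : ℚ_[p])) := by
  have hu' := fun h => hu (isSquare_coe (isSquare_unit_of_toZMod hp2 u h))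
  have hv' := fun h => hv (isSquare_coe (isSquare_unit_of_toZMod hp2 v h))
  have key : IsSquare (PadicInt.toZMod ((u * v : ℤ_[p]ˣ) : ℤ_[p])) := by
    have hu1 := quadraticChar_neg_one_iff_not_isSquare.mpr hu'
    have hv1 := quadraticChar_neg_one_iff_not_isSquare.mpr hv'
    refine (quadraticChar_one_iff_isSquare (toZMod_unit_ne_zero _)).mp ?_
    rw [Units.val_mul, map_mul, map_mul, hu1, hv1]
    norm_num
  have := isSquare_coe (isSquare_unit_of_toZMod hp2 (u * v) key)
  simpa using this

/-- Up to squares, a nonzero `p`-adic number is a unit or `p` times a unit. -/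
theorem exists_unit_mul_sq {x : ℚ_[p]} (hx : x ≠ 0) :
    ∃ (u : ℤ_[p]ˣ) (c : ℚ_[p]), c ≠ 0 ∧
      (x = (u : ℤ_[p]) * c ^ 2 ∨ x = p * (u : ℤ_[p]) * c ^ 2) := by
  have hp0 : (p : ℚ_[p]) ≠ 0 := by exact_mod_cast hp.out.ne_zero
  have hn : ‖x * (p : ℚ_[p]) ^ (-x.valuation)‖ = 1 := by
    rw [norm_mul, Padic.norm_eq_zpow_neg_valuation hx, norm_zpow, Padic.norm_p, inv_zpow]
    exact mul_inv_cancel₀ (zpow_ne_zero _ (by exact_mod_cast hp.out.ne_zero))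
  refine ⟨PadicInt.mkUnits hn, (p : ℚ_[p]) ^ (x.valuation / 2), zpow_ne_zero _ hp0, ?_⟩
  rw [PadicInt.mkUnits_eq, ← zpow_natCast, ← zpow_mul]
  rcases Int.even_or_odd' x.valuation with ⟨k, hk | hk⟩
  · left
    rw [mul_assoc, ← zpow_add₀ hp0, hk]
    have : -(2 * k) + 2 * k / 2 * (2 : ℕ) = 0 := by push_cast; omega
    rw [this]; simp
  · right
    rw [mul_comm (p : ℚ_[p]), mul_assoc, mul_assoc, ← zpow_one_add₀ hp0, ← zpow_add₀ hp0, hk]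
    have : -(2 * k + 1) + (1 + (2 * k + 1) / 2 * (2 : ℕ)) = 0 := by push_cast; omega
    rw [this]; simp

theorem norm_sq_ne_norm_p_mul_unit (x : ℚ_[p]) (u : ℤ_[p]ˣ) :
    ‖x ^ 2‖ ≠ ‖(p : ℚ_[p]) * (u : ℤ_[p])‖ := by
  rw [norm_mul, PadicInt.padic_norm_e_of_padicInt, PadicInt.norm_units, mul_one, norm_pow,
    Padic.norm_p]
  have hp1 : (1 : ℝ) < p := by exact_mod_cast hp.out.one_lt
  by_cases hx : x = 0
  · simpa [hx] using (zero_lt_one.trans hp1).ne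
  · rw [Padic.norm_eq_zpow_neg_valuation hx, ← zpow_natCast, ← zpow_mul, ← zpow_neg_one]
    intro h
    have := zpow_right_injective₀ (by linarith) hp1.ne' h
    push_cast at this
    omega

/-- In pv = x² - uy² the left side has odd valuation and both terms on the right have even
valuation. So x² dominates, and uy²/x² = 1 - pv/x² is a square by Hensel's lemma. -/
theorem isSquare_of_isNormValue_p_mul_unit (hp2 : p ≠ 2) {u v : ℤ_[p]ˣ}
    (h : IsNormValue ((u : ℤ_[p]) : ℚ_[p]) (p * (v : ℤ_[p]))) :
    IsSquare ((u : ℤ_[p]) : ℚ_[p]) := by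
  obtain ⟨x, y, h⟩ := h
  rcases lt_trichotomy ‖x ^ 2‖ ‖(p : ℚ_[p]) * (v : ℤ_[p])‖ with hlt | heq | hgt
  · exfalso
    have h1 : ‖x ^ 2 - (p : ℚ_[p]) * (v : ℤ_[p])‖ = ‖(p : ℚ_[p]) * (v : ℤ_[p])‖ := by
      rw [sub_eq_add_neg, IsUltrametricDist.norm_add_eq_max_of_norm_ne_norm (by
        rw [norm_neg]; exact hlt.ne), norm_neg, max_eq_right hlt.le]
    have h2 : x ^ 2 - (p : ℚ_[p]) * (v : ℤ_[p]) = (u : ℤ_[p]) * y ^ 2 := by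
      linear_combination -h
    rw [h2, norm_mul, PadicInt.padic_norm_e_of_padicInt, PadicInt.norm_units, one_mul] at h1
    exact norm_sq_ne_norm_p_mul_unit y v h1
  · exact absurd heq (norm_sq_ne_norm_p_mul_unit x v)
  · have hx : x ≠ 0 := by
      rintro rfl
      simp at hgt
      exact absurd hgt (not_lt.mpr (by positivity))
    have hz : ‖(1 - p * (v : ℤ_[p]) / x ^ 2 : ℚ_[p]) - 1‖ < 1 := by
      rw [sub_sub_cancel_left, norm_neg, norm_div]
      exact (div_lt_one (norm_pos_iff.mpr (pow_ne_zero _ hx))).mpr hgt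
    have hz1 : ‖(1 - p * (v : ℤ_[p]) / x ^ 2 : ℚ_[p])‖ ≤ 1 := by
      have := IsUltrametricDist.norm_add_le_max
        ((1 - p * (v : ℤ_[p]) / x ^ 2 : ℚ_[p]) - 1) 1
      rw [sub_add_cancel, norm_one] at this
      exact this.trans (max_le hz.le le_rfl)
    obtain ⟨w, hw⟩ := isSquare_coe (isSquare_of_norm_sub_one_lt_one hp2
      (z := ⟨1 - p * (v : ℤ_[p]) / x ^ 2, hz1⟩) hz)
    have hw' : (1 - p * (v : ℤ_[p]) / x ^ 2 : ℚ_[p]) = w * w := hw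
    have hy : y ≠ 0 := by
      rintro rfl
      exact norm_sq_ne_norm_p_mul_unit x v (by rw [h]; simp)
    refine ⟨w * x / y, ?_⟩
    field_simp at hw' ⊢
    linear_combination hw' + h

/-- By counting, the conic x² - uy² = v has a point over 𝔽_p. Lifting its coordinates to ℤ_p gives v
times a nonzero square. -/
theorem isNormValue_units (hp2 : p ≠ 2) (u v : ℤ_[p]ˣ) :
    IsNormValue ((u : ℤ_[p]) : ℚ_[p]) ((v : ℤ_[p]) : ℚ_[p]) := by
  by_cases hu : IsSquare ((u : ℤ_[p]) : ℚ_[p])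
  · exact .of_isSquare_left two_ne_zero_padic (coe_unit_ne_zero u) hu _
  set U := PadicInt.toZMod (u : ℤ_[p])
  set V := PadicInt.toZMod (v : ℤ_[p])
  have hU : U ≠ 0 := toZMod_unit_ne_zero u
  obtain ⟨r, s, hrs⟩ := FiniteField.exists_root_sum_quadratic (R := ZMod p)
    (f := Polynomial.X ^ 2) (g := Polynomial.C (-U) * Polynomial.X ^ 2 + Polynomial.C (-V))
    (Polynomial.degree_X_pow 2) (by
      have := Polynomial.degree_quadratic (a := -U) (b := 0) (c := -V) (neg_ne_zero.mpr hU)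
      simpa using this) (by rw [ZMod.card]; exact (hp.out.eq_two_or_odd.resolve_left hp2))
  obtain ⟨x, rfl⟩ := ZMod.ringHom_surjective (PadicInt.toZMod (p := p)) r
  obtain ⟨y, rfl⟩ := ZMod.ringHom_surjective (PadicInt.toZMod (p := p)) s
  obtain ⟨w, hw⟩ := isSquare_mul_of_toZMod_eq hp2 v (v := x ^ 2 - u * y ^ 2) (by
    simp at hrs
    simp only [map_sub, map_mul, map_pow]
    linear_combination hrs)
  have hw0 : w ≠ 0 := by
    rintro rfl
    have h0 : PadicInt.toZMod (x ^ 2 - (u : ℤ_[p]) * y ^ 2) = 0 := by rw [hw]; simp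
    simp at hrs
    simp only [map_sub, map_mul, map_pow] at h0
    exact toZMod_unit_ne_zero v (by linear_combination h0 - hrs)
  refine .of_mul_sq (c := (w : ℚ_[p])) (by simpa using hw0) ⟨x, y, ?_⟩
  simpa using congrArg (fun z : ℤ_[p] => (z : ℚ_[p])) hw.symm

/-- The norm group has index at most two. For a a unit up to squares, non-norms have odd valuation.
For a of odd valuation, each non-norm becomes a norm after multiplication by a non-square unit, and
the product of two such units is a square. -/
theorem isNormValue_mul_of_not_isNormValue (hp2 : p ≠ 2) {a b t : ℚ_[p]} (ha : a ≠ 0) (hb : b ≠ 0)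
    (ht : t ≠ 0) (hab : ¬ IsNormValue a b) (hat : ¬ IsNormValue a t) : IsNormValue a (b * t) := by
  obtain ⟨u, c, hc, rfl | rfl⟩ := exists_unit_mul_sq ha
  · have key : ∀ x : ℚ_[p], x ≠ 0 → ¬ IsNormValue (((u : ℤ_[p]) : ℚ_[p]) * c ^ 2) x →
        ∃ (v : ℤ_[p]ˣ) (e : ℚ_[p]), x = p * (v : ℤ_[p]) * e ^ 2 := by
      intro x hx hn
      obtain ⟨v, e, he, h | h⟩ := exists_unit_mul_sq hx
      · rw [h] at hn
        exact absurd (((isNormValue_units hp2 u v).mul_sq e).mul_sq_left hc) hn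
      · exact ⟨v, e, h⟩
    obtain ⟨v, e, rfl⟩ := key b hb hab
    obtain ⟨w, f, rfl⟩ := key t ht hat
    have := ((isNormValue_units hp2 u (v * w)).mul_sq (p * e * f)).mul_sq_left hc
    convert this using 1
    push_cast
    ring
  · have key : ∀ x : ℚ_[p], x ≠ 0 → ¬ IsNormValue ((p : ℚ_[p]) * (u : ℤ_[p]) * c ^ 2) x →
        ∃ v : ℤ_[p]ˣ, ¬ IsSquare ((v : ℤ_[p]) : ℚ_[p]) ∧
          IsNormValue ((p : ℚ_[p]) * (u : ℤ_[p]) * c ^ 2) (x * (v : ℤ_[p])) := by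
      intro x hx hn
      have hsuff : ∀ v : ℤ_[p]ˣ,
          IsNormValue ((p : ℚ_[p]) * (u : ℤ_[p]) * c ^ 2) (x * (v : ℤ_[p])) →
          ¬ IsSquare ((v : ℤ_[p]) : ℚ_[p]) := fun v hv hsq =>
        hn (hv.of_mul (coe_unit_ne_zero v) (.of_isSquare_right hsq))
      obtain ⟨v, e, he, h | h⟩ := exists_unit_mul_sq hx
      · have h1 : IsNormValue ((p : ℚ_[p]) * (u : ℤ_[p]) * c ^ 2) (x * (v : ℤ_[p])) :=
          .of_isSquare_right ⟨(v : ℤ_[p]) * e, by rw [h]; ring⟩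
        exact ⟨v, hsuff v h1, h1⟩
      -- Here x = pve², so x · (-uv) = -(pu)(ve)², which is -a up to squares.
      · have h1 : IsNormValue ((p : ℚ_[p]) * (u : ℤ_[p]) * c ^ 2)
            (x * ((-(u * v) : ℤ_[p]ˣ) : ℤ_[p])) := by
          convert ((IsNormValue.neg_self _).mul_sq ((v : ℤ_[p]) * e)).mul_sq_left hc using 1
          rw [h]
          push_cast
          ring
        exact ⟨-(u * v), hsuff _ h1, h1⟩
    obtain ⟨v, hv, hbv⟩ := key b hb hab
    obtain ⟨w, hw, htw⟩ := key t ht hat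
    refine .of_mul (mul_ne_zero (coe_unit_ne_zero v) (coe_unit_ne_zero w)) ?_
      (.of_isSquare_right (isSquare_coe_mul_of_not_isSquare hp2 hv hw))
    convert hbv.mul htw using 1
    ring

theorem isSquare_mul_sq {K : Type*} [Field K] {x : K} (c : K) (h : IsSquare x) :
    IsSquare (x * c ^ 2) := h.mul ⟨c, sq c⟩

/-- If `(a, b)` is split over `ℚ_[p]`, or `-d` is not a square, then `(a, b)` and some `(-d, c)` have
a common slot `t`. -/
theorem exists_common_slot_padic (hp2 : p ≠ 2) {a b d : ℚ_[p]} (ha : a ≠ 0) (hb : b ≠ 0)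
    (hd : d ≠ 0) (h : IsSquare (-d) → IsNormValue a b) :
    ∃ t : ℚ_[p], t ≠ 0 ∧ IsNormValue a (b * t) ∧ IsNormValue (-(a * d)) t := by
  have h2 : (2 : ℚ_[p]) ≠ 0 := two_ne_zero_padic
  by_cases hab : IsNormValue a b
  · exact ⟨1, one_ne_zero, by simpa using hab, .one _⟩
  have hd' : ¬ IsSquare (-d) := fun h' => hab (h h')
  have ha' : ¬ IsSquare a := fun h' => hab (.of_isSquare_left h2 ha h' b)
  have had : -(a * d) ≠ 0 := neg_ne_zero.mpr (mul_ne_zero ha hd)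
  by_cases hsq : IsSquare (-(a * d))
  · exact ⟨b, hb, .of_isSquare_right ⟨b, rfl⟩, .of_isSquare_left h2 had hsq b⟩
  -- As b is not a norm, t has to be a non-norm for a. It exists because a and -ad are non-squares
  -- in different square classes; the cases below are the parities of their valuations.
  suffices ∃ t : ℚ_[p], t ≠ 0 ∧ ¬ IsNormValue a t ∧ IsNormValue (-(a * d)) t by
    obtain ⟨t, ht, hat, hdt⟩ := this
    exact ⟨t, ht, isNormValue_mul_of_not_isNormValue hp2 ha hb ht hab hat, hdt⟩
  have hslot : IsNormValue (-(a * d)) (a * d) := by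
    simpa using IsNormValue.neg_self (-(a * d))
  have had' : a * d ≠ 0 := mul_ne_zero ha hd
  obtain ⟨u, c, hc, hu⟩ := exists_unit_mul_sq ha
  obtain ⟨v, e, he, hv⟩ := exists_unit_mul_sq had
  have hda : ∀ w : ℚ_[p], a * -(a * d) = w * w → IsSquare (-d) := fun w hw =>
    ⟨w / a, by field_simp; linear_combination hw⟩
  rcases hu with hu | hu <;> rcases hv with hv | hv
  · obtain ⟨w, hw⟩ := isSquare_coe_mul_of_not_isSquare hp2
      (fun h' => ha' (hu ▸ isSquare_mul_sq c h')) (fun h' => hsq (hv ▸ isSquare_mul_sq e h'))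
    refine absurd (hda (w * c * e) ?_) hd'
    rw [hv]
    nth_rw 1 [hu]
    linear_combination c ^ 2 * e ^ 2 * hw
  · refine ⟨a * d, had', fun hn => ha' ?_, hslot⟩
    have hn' : IsNormValue ((u : ℤ_[p]) : ℚ_[p]) (p * ((-v : ℤ_[p]ˣ) : ℤ_[p])) := by
      rw [hu] at hn
      refine .of_mul_sq he ?_
      convert hn.of_mul_sq_left using 1
      rw [← hu]
      push_cast
      linear_combination hv
    rw [hu]
    exact isSquare_mul_sq c (isSquare_of_isNormValue_p_mul_unit hp2 hn')
  · refine ⟨-(a * d), had, fun hn => hsq ?_, ?_⟩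
    · have hn' : IsNormValue ((v : ℤ_[p]) : ℚ_[p]) (p * (u : ℤ_[p])) := by
        have := hn.symm h2 had
        rw [hv] at this
        refine .of_mul_sq hc ?_
        rw [← hu]
        exact this.of_mul_sq_left
      rw [hv]
      exact isSquare_mul_sq e (isSquare_of_isNormValue_p_mul_unit hp2 hn')
    · rw [hv]
      exact ((isNormValue_units hp2 v v).mul_sq e).mul_sq_left he
  · refine ⟨a * d, had', fun hn => hd' ?_, hslot⟩
    have hn1 : IsNormValue a (-d) := by
      refine .of_mul (neg_ne_zero.mpr ha) ?_ (.neg_self a)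
      convert hn using 1
      ring
    have hn2 : IsNormValue (((u * v : ℤ_[p]ˣ) : ℤ_[p]) : ℚ_[p]) (p * (u : ℤ_[p])) := by
      have h3 := (hn1.symm h2 (neg_ne_zero.mpr hd)).mul_sq_left ha
      have h4 : -d * a ^ 2 = (((u * v : ℤ_[p]ˣ) : ℤ_[p]) : ℚ_[p]) * (p * c * e) ^ 2 := by
        push_cast
        linear_combination a * hv + p * (v : ℤ_[p]) * e ^ 2 * hu
      rw [h4] at h3
      refine .of_mul_sq hc ?_
      rw [← hu]
      exact h3.of_mul_sq_left
    obtain ⟨w, hw⟩ := isSquare_of_isNormValue_p_mul_unit hp2 hn2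
    push_cast at hw
    refine hda (w * p * c * e) ?_
    linear_combination a * hv + p * (v : ℤ_[p]) * e ^ 2 * hu + p ^ 2 * c ^ 2 * e ^ 2 * hw

/-- The common slot can be taken to be `p ^ ν * n`, for any integer `n` in some nonzero residue
class modulo `p`. -/
theorem exists_common_slot_residue (hp2 : p ≠ 2) {a b d : ℚ_[p]} (ha : a ≠ 0) (hb : b ≠ 0)
    (hd : d ≠ 0) (h : IsSquare (-d) → IsNormValue a b) :
    ∃ (ν : ℕ) (r : ZMod p), r ≠ 0 ∧ ∀ n : ℤ, (n : ZMod p) = r →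
      IsNormValue a (b * ((p : ℚ_[p]) ^ ν * n)) ∧ IsNormValue (-(a * d)) ((p : ℚ_[p]) ^ ν * n) := by
  obtain ⟨t, ht, h1, h2⟩ := exists_common_slot_padic hp2 ha hb hd h
  obtain ⟨u, c, hc, hu⟩ := exists_unit_mul_sq ht
  have hu' : ∃ ν : ℕ, t = (p : ℚ_[p]) ^ ν * (u : ℤ_[p]) * c ^ 2 := by
    rcases hu with hu | hu
    · exact ⟨0, by simpa using hu⟩
    · exact ⟨1, by simpa using hu⟩
  obtain ⟨ν, hν⟩ := hu'
  refine ⟨ν, PadicInt.toZMod (u : ℤ_[p]), toZMod_unit_ne_zero u, fun n hn => ?_⟩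
  -- For odd p the square class of a unit depends only on its residue.
  obtain ⟨w, hw⟩ := isSquare_mul_of_toZMod_eq hp2 u (v := (n : ℤ_[p])) (by simpa using hn)
  have hw' : (n : ℚ_[p]) = (u : ℤ_[p]) * (w : ℚ_[p]) ^ 2 := by
    simpa using congrArg (fun z : ℤ_[p] => (z : ℚ_[p])) hw
  have key : (p : ℚ_[p]) ^ ν * n * c ^ 2 = t * (w : ℚ_[p]) ^ 2 := by
    rw [hν, hw']
    ring
  constructor
  · refine .of_mul_sq hc ?_
    rw [mul_assoc, key, ← mul_assoc]
    exact h1.mul_sq _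
  · refine .of_mul_sq hc ?_
    rw [key]
    exact h2.mul_sq _

theorem exists_unit_eq_intCast {n : ℤ} (hn : ¬ (p : ℤ) ∣ n) :
    ∃ u : ℤ_[p]ˣ, ((u : ℤ_[p]) : ℚ_[p]) = n := by
  have h : IsUnit (n : ℤ_[p]) := by
    rw [PadicInt.isUnit_iff]
    exact le_antisymm (PadicInt.norm_le_one _)
      (not_lt.mp ((PadicInt.norm_int_lt_one_iff_dvd n).not.mpr hn))
  exact ⟨h.unit, by simp⟩

theorem isNormValue_intCast (hp2 : p ≠ 2) {m n : ℤ} (hm : ¬ (p : ℤ) ∣ m) (hn : ¬ (p : ℤ) ∣ n) :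
    IsNormValue (m : ℚ_[p]) n := by
  obtain ⟨u, hu⟩ := exists_unit_eq_intCast hm
  obtain ⟨v, hv⟩ := exists_unit_eq_intCast hn
  rw [← hu, ← hv]
  exact isNormValue_units hp2 u v

theorem isSquare_intCast_padic (hp2 : p ≠ 2) {n : ℤ} (hn : ¬ (p : ℤ) ∣ n)
    (h : IsSquare (n : ZMod p)) : IsSquare (n : ℚ_[p]) := by
  have hu : IsUnit (n : ℤ_[p]) := by
    rw [PadicInt.isUnit_iff]
    exact le_antisymm (PadicInt.norm_le_one _)
      (not_lt.mp ((PadicInt.norm_int_lt_one_iff_dvd n).not.mpr hn))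
  have := isSquare_coe (isSquare_unit_of_toZMod hp2 hu.unit (by simpa using h))
  simpa using this

theorem isSquare_zmod_of_padic {n : ℤ} (h : IsSquare (n : ℚ_[p])) : IsSquare (n : ZMod p) := by
  obtain ⟨x, hx⟩ := h
  have hx1 : ‖x‖ ≤ 1 := by
    have := Padic.norm_int_le_one (p := p) n
    rw [hx, norm_mul] at this
    nlinarith [norm_nonneg x]
  let y : ℤ_[p] := ⟨x, hx1⟩
  have hy : (n : ℤ_[p]) = y * y := Subtype.ext (by simpa using hx)
  exact ⟨PadicInt.toZMod y, by rw [← map_mul, ← hy, map_intCast]⟩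

theorem not_isSquare_p_mul {n : ℤ} (hn : ¬ (p : ℤ) ∣ n) : ¬ IsSquare ((p : ℚ_[p]) * n) := by
  obtain ⟨u, hu⟩ := exists_unit_eq_intCast hn
  rintro ⟨x, hx⟩
  exact norm_sq_ne_norm_p_mul_unit x u (by rw [hu, hx, sq])

theorem isSquare_zmod_of_isNormValue (hp2 : p ≠ 2) {m n : ℤ} (hm : ¬ (p : ℤ) ∣ m)
    (hn : ¬ (p : ℤ) ∣ n) (h : IsNormValue (m : ℚ_[p]) (p * n)) : IsSquare (m : ZMod p) := by
  obtain ⟨u, hu⟩ := exists_unit_eq_intCast hm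
  obtain ⟨v, hv⟩ := exists_unit_eq_intCast hn
  rw [← hu, ← hv] at h
  have := isSquare_of_isNormValue_p_mul_unit hp2 h
  rw [hu] at this
  exact isSquare_zmod_of_padic this

end Local

/-! ### Legendre's theorem, Dirichlet's theorem and the global common slot. -/

section Global

theorem exists_squarefree_mul_sq {n : ℤ} (hn : n ≠ 0) :
    ∃ s k : ℤ, Squarefree s ∧ k ≠ 0 ∧ n = s * k ^ 2 := by
  obtain ⟨s, k, h, hs⟩ := Nat.sq_mul_squarefree n.natAbs
  have hk : (k : ℤ) ≠ 0 := by
    rintro hk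
    have hk' : k = 0 := by exact_mod_cast hk
    subst hk'
    exact hn (Int.natAbs_eq_zero.mp (by rw [← h]; simp))
  have h' : (n.natAbs : ℤ) = (k : ℤ) ^ 2 * s := by rw [← h]; push_cast; ring
  rcases Int.natAbs_eq n with e | e
  · exact ⟨s, k, Int.squarefree_natCast.mpr hs, hk, by rw [e, h']; ring⟩
  · exact ⟨-s, k, by simpa [← Int.squarefree_natAbs] using hs, hk, by rw [e, h']; ring⟩

theorem isSquare_zmod_of_squarefree {n : ℕ} (hn : Squarefree n) (a : ℤ)
    (h : ∀ p : ℕ, p.Prime → p ∣ n → IsSquare (a : ZMod p)) : IsSquare (a : ZMod n) := by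
  induction n using induction_on_primes with
  | zero => exact absurd hn not_squarefree_zero
  | one => exact ⟨0, Subsingleton.elim _ _⟩
  | prime_mul p n hp ih =>
    have hcp : p.Coprime n := by
      by_contra hc
      exact hp.not_isUnit (hn p <| mul_dvd_mul_left p <| hp.dvd_iff_not_coprime.mpr hc)
    obtain ⟨x, hx⟩ := h p hp (dvd_mul_right p n)
    obtain ⟨y, hy⟩ := ih hn.of_mul_right fun q hq hqn => h q hq (hqn.mul_left p)
    have hsq : IsSquare ((a : ZMod p × ZMod n)) := ⟨(x, y), by
      ext
      · simpa using hx
      · simpa using hy⟩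
    simpa only [map_intCast] using hsq.map (ZMod.chineseRemainder hcp).symm

theorem exists_sq_eq_add_mul {a b : ℤ} (hb : b ≠ 0) (h : IsSquare (a : ZMod b.natAbs)) :
    ∃ t c : ℤ, t ^ 2 = a + b * c ∧ 2 * |t| ≤ |b| := by
  obtain ⟨x, hx⟩ := h
  have : NeZero b.natAbs := ⟨Int.natAbs_ne_zero.mpr hb⟩
  have hx2 : 2 * |x.valMinAbs| ≤ |b| := by
    have := ZMod.natAbs_valMinAbs_le x
    rw [Int.abs_eq_natAbs, Int.abs_eq_natAbs]
    omega
  have hdvd : b ∣ x.valMinAbs ^ 2 - a := by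
    rw [← Int.natAbs_dvd, ← ZMod.intCast_zmod_eq_zero_iff_dvd]
    push_cast
    simp [hx, sq]
  obtain ⟨c, hc⟩ := hdvd
  exact ⟨x.valMinAbs, c, by linear_combination hc, hx2⟩

theorem zmod_two_mul_self : ∀ x : ZMod 2, x * x = x := by decide

/-- Legendre's descent. Let |a| ≤ |b|. The local conditions make a a square modulo b, so t² = a + bc
with |t| ≤ |b|/2. Then bc is a norm, and b may be replaced by the squarefree part of c, which is
smaller. -/
theorem isNormValue_of_squarefree (n : ℕ) : ∀ a b : ℤ, a.natAbs + b.natAbs ≤ n → Squarefree a →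
    Squarefree b → (0 < a ∨ 0 < b) →
    (∀ (p : ℕ) [Fact p.Prime], p ≠ 2 → IsNormValue (a : ℚ_[p]) b) → IsNormValue (a : ℚ) b := by
  induction n using Nat.strong_induction_on with
  | _ n ih =>
  intro a b hn ha hb hpos hloc
  have ha0 := ha.ne_zero
  have hb0 := hb.ne_zero
  wlog hle : a.natAbs ≤ b.natAbs generalizing a b
  · refine (this b a (by omega) hb ha hpos.symm (fun p _ hp2 => ?_) hb0 ha0 (by omega)).symm
      two_ne_zero (by exact_mod_cast ha0)
    exact (hloc p hp2).symm two_ne_zero_padic (by exact_mod_cast hb0)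
  rcases Nat.lt_or_ge 1 b.natAbs with hb1 | hb1
  swap
  · have h1 : a.natAbs = 1 := by omega
    have h2 : b.natAbs = 1 := by omega
    rcases hpos with h | h
    · have : a = 1 := by omega
      subst this
      exact .of_isSquare_left two_ne_zero (by simp) (by simp) _
    · have : b = 1 := by omega
      subst this
      simpa using IsNormValue.one (a : ℚ)
  have hsq : IsSquare (a : ZMod b.natAbs) := by
    refine isSquare_zmod_of_squarefree (Int.squarefree_natAbs.mpr hb) a fun p hp hpb => ?_
    have := Fact.mk hp
    have hpb' : (p : ℤ) ∣ b := Int.natCast_dvd.mpr hpb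
    by_cases hpa : (p : ℤ) ∣ a
    · rw [(ZMod.intCast_zmod_eq_zero_iff_dvd a p).mpr hpa]
      exact ⟨0, by simp⟩
    -- Every residue modulo 2 is a square, so the descent needs no condition at 2.
    by_cases hp2 : p = 2
    · subst hp2
      exact ⟨a, (zmod_two_mul_self _).symm⟩
    obtain ⟨c, hc⟩ := hpb'
    have hpc : ¬ (p : ℤ) ∣ c := fun ⟨e, he⟩ =>
      (Nat.prime_iff_prime_int.mp hp).not_isUnit (hb p ⟨e, by rw [hc, he]; ring⟩)
    refine isSquare_zmod_of_isNormValue hp2 hpa hpc ?_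
    have := hloc p hp2
    rw [hc] at this
    exact_mod_cast this
  obtain ⟨t, c, htc, htb⟩ := exists_sq_eq_add_mul hb0 hsq
  by_cases hc0 : c = 0
  · subst hc0
    refine .of_isSquare_left two_ne_zero (by exact_mod_cast ha0) ⟨(t : ℚ), ?_⟩ _
    have : t * t = a := by linear_combination htc
    exact_mod_cast this.symm
  have hlt : |c| < |b| := by
    have hB : 2 ≤ |b| := by rw [Int.abs_eq_natAbs]; omega
    have hA : |a| ≤ |b| := by rw [Int.abs_eq_natAbs, Int.abs_eq_natAbs]; omega
    have h1 : |b| * |c| ≤ |t| ^ 2 + |a| := by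
      rw [← abs_mul, show b * c = t ^ 2 - a by linear_combination -htc, ← abs_pow]
      exact abs_sub _ _
    by_contra hge
    nlinarith [abs_nonneg t, abs_nonneg c]
  obtain ⟨s, k, hs, hk, rfl⟩ := exists_squarefree_mul_sq hc0
  have hbc : ∀ (K : Type) [Field K] [CharZero K], IsNormValue (a : K) (b : K) ↔
      IsNormValue (a : K) (s : K) := by
    intro K _ _
    have hk' : (k : K) ≠ 0 := by exact_mod_cast hk
    have hb' : (b : K) ≠ 0 := by exact_mod_cast hb0
    have hs' : (s : K) ≠ 0 := by exact_mod_cast hs.ne_zero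
    have h1 : IsNormValue (a : K) ((b : K) * s) := by
      refine .of_mul_sq hk' ⟨t, 1, ?_⟩
      have := congrArg (fun z : ℤ => (z : K)) htc
      push_cast at this
      linear_combination -this
    exact ⟨fun h => .of_mul hb' (by rwa [mul_comm]) h, fun h => .of_mul hs' h1 h⟩
  rw [hbc]
  have hsk : |s| ≤ |s * k ^ 2| := by
    rw [abs_mul]
    have : 1 ≤ |k ^ 2| := Int.one_le_abs (pow_ne_zero _ hk)
    nlinarith [abs_nonneg s]
  refine ih (a.natAbs + s.natAbs) ?_ a s le_rfl ha hs ?_ fun p _ hp2 => ?_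
  · rw [Int.abs_eq_natAbs, Int.abs_eq_natAbs] at hlt
    rw [Int.abs_eq_natAbs, Int.abs_eq_natAbs] at hsk
    omega
  -- If a < 0 then b > 0, and 0 ≤ t² = a + bsk² excludes s ≤ 0.
  · by_contra! hcon
    have ha' : a < 0 := lt_of_le_of_ne hcon.1 ha0
    have hb' : 0 < b := hpos.resolve_left (by omega)
    have : b * (s * k ^ 2) ≤ 0 :=
      mul_nonpos_of_nonneg_of_nonpos hb'.le (mul_nonpos_of_nonpos_of_nonneg hcon.2 (sq_nonneg k))
    nlinarith [sq_nonneg t]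
  · exact (hbc ℚ_[p]).mp (hloc p hp2)

/-- Legendre's theorem on ternary forms, as a local-global principle. The place `2` is not needed. -/
theorem isNormValue_of_forall_padic {a b : ℤ} (ha : a ≠ 0) (hb : b ≠ 0) (hpos : 0 < a ∨ 0 < b)
    (h : ∀ (p : ℕ) [Fact p.Prime], p ≠ 2 → IsNormValue (a : ℚ_[p]) b) :
    IsNormValue (a : ℚ) b := by
  obtain ⟨s, k, hs, hk, rfl⟩ := exists_squarefree_mul_sq ha
  obtain ⟨r, l, hr, hl, rfl⟩ := exists_squarefree_mul_sq hb
  have key := isNormValue_of_squarefree _ s r le_rfl hs hr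
    (hpos.imp (fun h => pos_of_mul_pos_left h (sq_nonneg k))
      (fun h => pos_of_mul_pos_left h (sq_nonneg l))) fun p _ hp2 => by
    have := h p hp2
    push_cast at this
    exact (this.of_mul_sq (by exact_mod_cast hl)).of_mul_sq_left
  push_cast
  exact (key.mul_sq _).mul_sq_left (by exact_mod_cast hk)

open NumberTheorySymbols in
/-- Dirichlet's theorem, with a quadratic condition added through the class modulo `8`. -/
theorem exists_prime_jacobiSym_eq_one {S : Finset ℕ} (hS : ∀ p ∈ S, p.Prime ∧ p ≠ 2) (g : ℕ → ℕ)
    (hg : ∀ p ∈ S, ¬ p ∣ g p) {m : ℕ} (hm : Odd m) (hmsq : Squarefree m)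
    (hmS : m.primeFactors ⊆ S) (B : ℕ) :
    ∃ l : ℕ, B < l ∧ l.Prime ∧ l % 4 = 1 ∧ (∀ p ∈ S, l ≡ g p [MOD p]) ∧
      J(-(2 * m) | l) = 1 := by
  have hcop : Set.Pairwise (S : Set ℕ) (Function.onFun Nat.Coprime (fun p => p)) :=
    fun p hp q hq hpq => (Nat.coprime_primes (hS p hp).1 (hS q hq).1).mpr hpq
  obtain ⟨w, hw⟩ := Nat.chineseRemainderOfFinset g (fun p => p) S
    (fun p hp => (hS p hp).1.ne_zero) hcop
  set M := ∏ p ∈ S, p with hM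
  have hpM : ∀ p ∈ S, p ∣ M := fun p hp => Finset.dvd_prod_of_mem (fun p => p) hp
  have hmM : m ∣ M := by
    rw [← Nat.prod_primeFactors_of_squarefree hmsq]
    exact Finset.prod_dvd_prod_of_subset _ _ _ hmS
  have hwM : Nat.Coprime w M := by
    refine Nat.Coprime.prod_right fun p hp => Nat.Coprime.symm ?_
    rw [(hS p hp).1.coprime_iff_not_dvd]
    exact fun h => hg p hp (((hw p hp).dvd_iff dvd_rfl).mp h)
  have h8M : Nat.Coprime 8 M := by
    refine Nat.Coprime.prod_right fun p hp => ?_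
    have : Nat.Coprime 2 p := (Nat.coprime_primes Nat.prime_two (hS p hp).1).mpr (hS p hp).2.symm
    exact this.pow_left 3
  have hM0 : M ≠ 0 := Finset.prod_ne_zero_iff.mpr fun p hp => (hS p hp).1.ne_zero
  have hJ : J(w | m) = 1 ∨ J(w | m) = -1 :=
    jacobiSym.eq_one_or_neg_one (by
      rw [Int.gcd_natCast_natCast]
      exact hwM.coprime_dvd_right hmM)
  -- Both classes modulo 8 are 1 mod 4, so (-1/l) = 1 and (m/l) = (l/m); they differ in (2/l), which
  -- is chosen equal to (l/m).
  obtain ⟨c, hc, hc'⟩ : ∃ c : ℕ, (c = 1 ∧ J(w | m) = 1 ∨ c = 5 ∧ J(w | m) = -1) ∧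
      Nat.Coprime c 8 := by
    rcases hJ with h | h
    · exact ⟨1, .inl ⟨rfl, h⟩, by norm_num⟩
    · exact ⟨5, .inr ⟨rfl, h⟩, by norm_num⟩
  obtain ⟨x, hx8, hxM⟩ := Nat.chineseRemainder h8M c w
  have hx : Nat.Coprime x (8 * M) := by
    refine Nat.Coprime.mul_right ?_ ?_
    · rw [Nat.Coprime, hx8.gcd_eq]; exact hc'
    · rw [Nat.Coprime, hxM.gcd_eq]; exact hwM
  obtain ⟨l, hBl, hl, hlx⟩ := Nat.forall_exists_prime_gt_and_modEq B
    (mul_ne_zero (by norm_num) hM0 : 8 * M ≠ 0) hx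
  have hl8 : l % 8 = c % 8 := (hlx.of_mul_right M).trans hx8
  have hlM : l ≡ w [MOD M] := (hlx.of_mul_left 8).trans hxM
  have hl4 : l % 4 = 1 := by rcases hc with ⟨rfl, -⟩ | ⟨rfl, -⟩ <;> omega
  have hlodd : Odd l := Nat.odd_iff.mpr (by omega)
  refine ⟨l, hBl, hl, hl4, fun p hp => (hlM.of_dvd (hpM p hp)).trans (hw p hp), ?_⟩
  have hlm : J(l | m) = J(w | m) := by
    refine jacobiSym.mod_left' ?_
    exact_mod_cast (hlM.of_dvd hmM : l % m = w % m)
  rw [jacobiSym.neg _ hlodd, ZMod.χ₄_nat_one_mod_four hl4, jacobiSym.mul_left,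
    jacobiSym.at_two hlodd, jacobiSym.quadratic_reciprocity_one_mod_four' hm hl4, hlm,
    ZMod.χ₈_nat_eq_if_mod_eight]
  rcases hc with ⟨rfl, h⟩ | ⟨rfl, h⟩
  · simp [h, hl8, Nat.odd_iff.mp hlodd]
  · simp [h, hl8, Nat.odd_iff.mp hlodd]

open NumberTheorySymbols in
theorem isSquare_neg_three_zmod_iff {p : ℕ} [hp : Fact p.Prime] (hp2 : p ≠ 2) :
    IsSquare ((-3 : ℤ) : ZMod p) ↔ p = 3 ∨ p % 3 = 1 := by
  by_cases hp3 : p = 3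
  · subst hp3
    simp only [true_or, iff_true]
    rw [(ZMod.intCast_zmod_eq_zero_iff_dvd (-3) 3).mpr (by norm_num)]
    exact IsSquare.zero
  have h0 : ((-3 : ℤ) : ZMod p) ≠ 0 := by
    rw [Ne, ZMod.intCast_zmod_eq_zero_iff_dvd, dvd_neg]
    exact fun h => hp3 ((Nat.prime_dvd_prime_iff_eq hp.out Nat.prime_three).mp (by exact_mod_cast h))
  have hodd : Odd p := hp.out.odd_of_ne_two hp2
  have hJ : J(-3 | p) = J(p | 3) := by
    rw [jacobiSym.neg _ hodd]
    have h3 : Odd 3 := by decide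
    rcases Nat.odd_mod_four_iff.mp (Nat.odd_iff.mp hodd) with h | h
    · rw [ZMod.χ₄_nat_one_mod_four h, one_mul]
      exact jacobiSym.quadratic_reciprocity_one_mod_four' h3 h
    · rw [ZMod.χ₄_nat_three_mod_four h]
      have := jacobiSym.quadratic_reciprocity_three_mod_four (a := 3) (by norm_num) h
      push_cast at this
      rw [this]; ring
  rw [← legendreSym.eq_one_iff p h0, jacobiSym.legendreSym.to_jacobiSym, hJ, jacobiSym.mod_left]
  have hp0 : p % 3 ≠ 0 := fun h =>
    hp3 ((Nat.prime_dvd_prime_iff_eq Nat.prime_three hp.out).mp (Nat.dvd_of_mod_eq_zero h)).symm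
  have : p % 3 = 1 ∨ p % 3 = 2 := by omega
  rcases this with h | h
  · have h' : (p : ℤ) % (3 : ℕ) = 1 := by omega
    rw [h', jacobiSym.one_left]
    simp [h]
  · have h' : (p : ℤ) % (3 : ℕ) = 2 := by omega
    rw [h', jacobiSym.at_two (by decide), ZMod.χ₈_nat_eq_if_mod_eight]
    simp [h, hp3]

theorem isSquare_neg_zmod {d : ℤ} (hd : d = 1 ∨ d = 3) {l : ℕ} [Fact l.Prime] (hl4 : l % 4 = 1)
    (hl3 : l % 3 = 1) : IsSquare ((-d : ℤ) : ZMod l) := by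
  rcases hd with rfl | rfl
  · push_cast
    exact ZMod.exists_sq_eq_neg_one_iff.mpr (by omega)
  · exact (isSquare_neg_three_zmod_iff (by rintro rfl; omega)).mpr (.inr hl3)

/-- As 2 generates the units modulo 3, a factor 2^e in t absorbs the condition at 3 and leaves l
free to be 1 mod 3. With l ≡ 1 mod 4 this makes both -1 and -3 squares modulo l. -/
theorem exists_neg_two_pow_mul : ∀ x y : ZMod 3, x ≠ 0 → y ≠ 0 →
    -(2 : ZMod 3) ^ 0 * x = y ∨ -(2 : ZMod 3) ^ 1 * x = y := by decide

/-- A common slot over `ℚ` of `(a, b)` and `(-d, c)` for some `c`. -/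
theorem exists_common_slot {m : ℕ} (hm : Odd m) (hmsq : Squarefree m) {a b d : ℤ}
    (ham : a = -(2 * m)) (hb : b < 0) (hd : d = 1 ∨ d = 3)
    (h : ∀ (p : ℕ) [Fact p.Prime], p ≠ 2 → IsSquare (-d : ℚ_[p]) → IsNormValue (a : ℚ_[p]) b) :
    ∃ t : ℤ, t ≠ 0 ∧ IsNormValue (a : ℚ) (b * t) ∧ IsNormValue (-(a * d) : ℚ) t := by
  have hm0 : 0 < m := hm.pos
  have ha : a < 0 := by omega
  have hd0 : 0 < d := by omega
  -- The factor 3 covers the prime divisors of d and lets l be prescribed modulo 3.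
  set n := (3 * a * b).natAbs with hn
  have hn0 : n ≠ 0 := by simp [hn, ha.ne, hb.ne]
  set S := n.primeFactors.erase 2 with hSdef
  have hS : ∀ p ∈ S, p.Prime ∧ p ≠ 2 := fun p hp =>
    ⟨Nat.prime_of_mem_primeFactors (Finset.mem_of_mem_erase hp), Finset.ne_of_mem_erase hp⟩
  have hmemS : ∀ p : ℕ, p.Prime → p ≠ 2 → (p : ℤ) ∣ 3 * a * b → p ∈ S := fun p hp hp2 hdvd =>
    Finset.mem_erase.mpr ⟨hp2, Nat.mem_primeFactors.mpr ⟨hp, Int.natCast_dvd.mp hdvd, hn0⟩⟩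
  have h3S : 3 ∈ S := hmemS 3 Nat.prime_three (by norm_num) ⟨a * b, by push_cast; ring⟩
  have hloc : ∀ p : ℕ, ∃ (ν : ℕ) (r : ℤ), p ∈ S → (r : ZMod p) ≠ 0 ∧
      ∀ [Fact p.Prime] (k : ℤ), (k : ZMod p) = r →
        IsNormValue (a : ℚ_[p]) (b * ((p : ℚ_[p]) ^ ν * k)) ∧
        IsNormValue (-(a * d) : ℚ_[p]) ((p : ℚ_[p]) ^ ν * k) := by
    intro p
    by_cases hp : p ∈ S
    · have := Fact.mk (hS p hp).1
      obtain ⟨ν, r, hr, H⟩ := exists_common_slot_residue (p := p) (hS p hp).2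
        (a := a) (b := b) (d := d) (by exact_mod_cast ha.ne) (by exact_mod_cast hb.ne)
        (by exact_mod_cast hd0.ne') (h p (hS p hp).2)
      obtain ⟨r, rfl⟩ := ZMod.intCast_surjective r
      exact ⟨ν, r, fun _ => ⟨hr, fun k hk => H k hk⟩⟩
    · exact ⟨0, 0, fun h => absurd h hp⟩
  choose ν r hloc using hloc
  let Q : ℕ → ℕ := fun p => ∏ q ∈ S.erase p, q ^ ν q
  have hQ0 : ∀ p ∈ S, (Q p : ZMod p) ≠ 0 := by
    intro p hp
    have := Fact.mk (hS p hp).1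
    simp only [Q, Nat.cast_prod, Nat.cast_pow]
    refine Finset.prod_ne_zero_iff.mpr fun q hq => pow_ne_zero _ ?_
    rw [Ne, ZMod.natCast_eq_zero_iff]
    exact fun hpq => Finset.ne_of_mem_erase hq ((Nat.prime_dvd_prime_iff_eq (hS p hp).1
      (hS q (Finset.mem_of_mem_erase hq)).1).mp hpq).symm
  have h20 : ∀ p ∈ S, (2 : ZMod p) ≠ 0 := by
    intro p hp h0
    exact (hS p hp).2 ((Nat.prime_dvd_prime_iff_eq (hS p hp).1 Nat.prime_two).mp
      ((ZMod.natCast_eq_zero_iff 2 p).mp (by exact_mod_cast h0)))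
  obtain ⟨e, he⟩ : ∃ e : ℕ, -(2 : ZMod 3) ^ e * Q 3 = r 3 :=
    (exists_neg_two_pow_mul (Q 3) (r 3) (hQ0 3 h3S) (hloc 3 h3S).1).elim
      (fun h => ⟨0, h⟩) (fun h => ⟨1, h⟩)
  have hres : ∀ p : ℕ, ∃ g : ℕ, p ∈ S →
      -(2 : ZMod p) ^ e * (Q p : ZMod p) * (g : ZMod p) = (r p : ZMod p) := by
    intro p
    by_cases hp : p ∈ S
    · have := Fact.mk (hS p hp).1
      obtain ⟨g, hg⟩ := ZMod.natCast_zmod_surjective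
        ((r p : ZMod p) / (-(2 : ZMod p) ^ e * (Q p : ZMod p)))
      refine ⟨g, fun _ => ?_⟩
      rw [hg]
      exact mul_div_cancel₀ _ (mul_ne_zero (neg_ne_zero.mpr (pow_ne_zero _ (h20 p hp))) (hQ0 p hp))
    · exact ⟨0, fun h => absurd h hp⟩
  choose g hg using hres
  obtain ⟨l, hnl, hl, hl4, hlg, hJ⟩ := exists_prime_jacobiSym_eq_one hS g
    (fun p hp hdvd => (hloc p hp).1 (by
      rw [← hg p hp, (ZMod.natCast_eq_zero_iff (g p) p).mpr hdvd, mul_zero])) hm hmsq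
    (fun p hp => by
      obtain ⟨hp, hpm, -⟩ := Nat.mem_primeFactors.mp hp
      refine hmemS p hp ?_ ?_
      · rintro rfl
        exact (Nat.not_even_iff_odd.mpr hm) (even_iff_two_dvd.mpr hpm)
      · rw [ham]
        exact ((Int.natCast_dvd_natCast.mpr hpm).mul_left 2).neg_right.mul_left 3 |>.mul_right b) n
  have hlfact := Fact.mk hl
  have hlg' : ∀ p ∈ S, (l : ZMod p) = g p := fun p hp =>
    (ZMod.natCast_eq_natCast_iff _ _ _).mpr (hlg p hp)
  have hl3 : l % 3 = 1 := by
    have h1 : (l : ZMod 3) = 1 := by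
      rw [hlg' 3 h3S]
      have h2 := hg 3 h3S
      rw [he] at h2
      exact mul_left_cancel₀ (hloc 3 h3S).1 (by rw [h2, mul_one])
    exact (ZMod.natCast_eq_natCast_iff l 1 3).mp (by exact_mod_cast h1)
  have hl2 : l ≠ 2 := by rintro rfl; omega
  have hlS : ¬ (l : ℤ) ∣ 3 * a * b := fun hdvd =>
    absurd (Nat.le_of_dvd (Nat.pos_of_ne_zero hn0) (Int.natCast_dvd.mp hdvd)) (by omega)
  have hdvd3 : ∀ k : ℤ, k ∣ a * d → k ∣ 3 * a * b := by
    intro k hk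
    refine Dvd.dvd.mul_right ?_ b
    rcases hd with rfl | rfl
    · simpa using hk.mul_left 3
    · rwa [mul_comm] at hk
  have hdvda : ∀ k : ℤ, k ∣ a → k ∣ 3 * a * b := fun k hk => (hk.mul_left 3).mul_right b
  -- The sign gives bt > 0, as the real place requires. The exponents and the residue of l fit the
  -- local slots at S, and t is a unit at odd primes outside S other than l.
  set t : ℤ := -(2 ^ e * (∏ q ∈ S, q ^ ν q : ℕ) * l) with ht
  have htneg : t < 0 := by
    rw [ht, neg_lt_zero]
    have : 0 < ∏ q ∈ S, q ^ ν q :=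
      Finset.prod_pos fun q hq => pow_pos (hS q hq).1.pos _
    have := hl.pos
    positivity
  have htp : ∀ p ∈ S, t = (p : ℤ) ^ ν p * (-(2 ^ e * Q p * l)) := by
    intro p hp
    have : ∏ q ∈ S, q ^ ν q = p ^ ν p * Q p := (Finset.mul_prod_erase S _ hp).symm
    rw [ht, this]
    push_cast
    ring
  have hint : ∀ p ∈ S, ∀ [Fact p.Prime], IsNormValue (a : ℚ_[p]) (b * t) ∧
      IsNormValue (-(a * d) : ℚ_[p]) t := by
    intro p hp _
    have := (hloc p hp).2 (-(2 ^ e * Q p * l)) (by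
      push_cast
      rw [hlg' p hp, ← hg p hp]
      ring)
    rw [htp p hp]
    exact_mod_cast this
  have htdvd : ∀ p : ℕ, p.Prime → p ≠ 2 → p ∉ S → p ≠ l → ¬ (p : ℤ) ∣ t := by
    intro p hp hp2 hpS hpl hdvd
    have hp' := Nat.prime_iff_prime_int.mp hp
    rw [ht, dvd_neg] at hdvd
    rcases hp'.dvd_or_dvd hdvd with h1 | h1
    · rcases hp'.dvd_or_dvd h1 with h1 | h1
      · have := hp'.dvd_of_dvd_pow h1
        exact hp2 ((Nat.prime_dvd_prime_iff_eq hp Nat.prime_two).mp (by exact_mod_cast this))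
      · rw [Int.natCast_dvd_natCast, hp.prime.dvd_finsetProd_iff] at h1
        obtain ⟨q, hq, hpq⟩ := h1
        have := (Nat.prime_dvd_prime_iff_eq hp (hS q hq).1).mp (hp.dvd_of_dvd_pow hpq)
        exact hpS (this ▸ hq)
    · exact hpl ((Nat.prime_dvd_prime_iff_eq hp hl).mp (by exact_mod_cast h1))
  -- At l both a and -ad are squares, so the norm conditions hold there although l divides t.
  have hal : IsSquare (a : ZMod l) := ZMod.isSquare_of_jacobiSym_eq_one (ham ▸ hJ)
  have hadl : IsSquare ((-(a * d) : ℤ) : ZMod l) := by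
    have := hal.mul (isSquare_neg_zmod hd hl4 hl3)
    rwa [← Int.cast_mul, mul_neg] at this
  refine ⟨t, htneg.ne, ?_, ?_⟩
  · have := isNormValue_of_forall_padic (a := a) (b := b * t) ha.ne (mul_ne_zero hb.ne htneg.ne)
      (.inr (mul_pos_of_neg_of_neg hb htneg)) fun p _ hp2 => ?_
    · exact_mod_cast this
    · have hp : p.Prime := Fact.out
      by_cases hpS : p ∈ S
      · exact_mod_cast (hint p hpS).1
      by_cases hpl : p = l
      · subst hpl
        exact .of_isSquare_left two_ne_zero_padic (by exact_mod_cast ha.ne)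
          (isSquare_intCast_padic hp2 (fun h => hlS (hdvda _ h)) hal) _
      · refine isNormValue_intCast hp2 (fun h => hpS (hmemS p hp hp2 (hdvda _ h))) fun h => ?_
        rcases (Nat.prime_iff_prime_int.mp hp).dvd_or_dvd h with h | h
        · exact hpS (hmemS p hp hp2 (h.mul_left _))
        · exact htdvd p hp hp2 hpS hpl h
  · have hadpos : 0 < -(a * d) := neg_pos.mpr (mul_neg_of_neg_of_pos ha hd0)
    have := isNormValue_of_forall_padic (a := -(a * d)) (b := t) hadpos.ne' htneg.ne
      (.inl hadpos) fun p _ hp2 => ?_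
    · exact_mod_cast this
    · have hp : p.Prime := Fact.out
      by_cases hpS : p ∈ S
      · exact_mod_cast (hint p hpS).2
      by_cases hpl : p = l
      · subst hpl
        exact .of_isSquare_left two_ne_zero_padic (by exact_mod_cast hadpos.ne')
          (isSquare_intCast_padic hp2 (fun h => hlS (hdvd3 _ ((dvd_neg).mp h))) hadl) _
      · exact isNormValue_intCast hp2
          (fun h => hpS (hmemS p hp hp2 (hdvd3 _ ((dvd_neg).mp h)))) (htdvd p hp hp2 hpS hpl)

end Global

/-! ### Squares of pure quaternions and changes of basis. -/

/-- The element `c` is the square of a pure quaternion of `(a, b / K)`. -/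
def IsPureSquare {K : Type*} [Field K] (a b c : K) : Prop :=
  ∃ x y z : K, a * x ^ 2 + b * y ^ 2 - a * b * z ^ 2 = c

namespace IsPureSquare

variable {K : Type*} [Field K] {a b c : K}

/-- The form ⟨a, d⟩ represents t/a and ⟨b, -ab⟩ represents -t/a up to squares; adding the two
cancels t and leaves -d. -/
theorem of_common_slot (h2 : (2 : K) ≠ 0) (ha : a ≠ 0) (hb : b ≠ 0) {d t : K} (ht : t ≠ 0)
    (h : IsNormValue a (b * t)) (h' : IsNormValue (-(a * d)) t) : IsPureSquare a b (-d) := by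
  obtain ⟨x, y, h⟩ := h
  obtain ⟨u, v, h'⟩ := h'.symm h2 ht
  refine ⟨u / a, v * y / b, v * x / (a * b), ?_⟩
  field_simp
  linear_combination v ^ 2 * h - b * h'

theorem symm (h : IsPureSquare a b c) : IsPureSquare b a c := by
  obtain ⟨x, y, z, h⟩ := h
  exact ⟨y, x, z, by linear_combination h⟩

theorem mul_sq_left {e : K} (he : e ≠ 0) (h : IsPureSquare a b c) :
    IsPureSquare (a * e ^ 2) b c := by
  obtain ⟨x, y, z, h⟩ := h
  refine ⟨x / e, y, z / e, ?_⟩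
  field_simp
  exact h

/-- Coordinates with respect to the generators i and k. -/
theorem of_neg_mul (h : IsPureSquare a (-(a * b)) c) : IsPureSquare a b c := by
  obtain ⟨x, y, z, h⟩ := h
  exact ⟨x, a * z, y, by linear_combination h⟩

/-- Coordinates with respect to the generators i + j and k. -/
theorem of_add (h : IsPureSquare (a + b) (-(a * b)) c) : IsPureSquare a b c := by
  obtain ⟨x, y, z, h⟩ := h
  exact ⟨x + b * z, x - a * z, y, by linear_combination h⟩

end IsPureSquare

/-! ### Existence over ℚ, by reduction to a ≡ 2 mod 4. -/

section Global

/-- Hypothesis on `(a, b)` at the odd places under which `-d` is the square of a pure quaternion. -/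
def SplitWhereSquare (a b d : ℤ) : Prop :=
  ∀ (p : ℕ) [Fact p.Prime], p ≠ 2 → IsSquare (-d : ℚ_[p]) → IsNormValue (a : ℚ_[p]) b

theorem isPureSquare_of_two_dvd {a b d : ℤ} (ha : a < 0) (ha2 : 2 ∣ a) (ha4 : ¬ 4 ∣ a) (hb : b < 0)
    (hd : d = 1 ∨ d = 3) (h : SplitWhereSquare a b d) : IsPureSquare (a : ℚ) b (-d) := by
  obtain ⟨s, k, hs, hk, rfl⟩ := exists_squarefree_mul_sq ha.ne
  have hs0 : s < 0 := by
    by_contra hcon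
    exact absurd (mul_nonneg (not_lt.mp hcon) (sq_nonneg k)) (not_le.mpr ha)
  have hk2 : ¬ 2 ∣ k := fun ⟨c, hc⟩ => ha4 ⟨s * c ^ 2, by rw [hc]; ring⟩
  obtain ⟨r, hr⟩ : 2 ∣ s := (Int.prime_two.dvd_or_dvd ha2).resolve_right fun h =>
    hk2 (Int.prime_two.dvd_of_dvd_pow h)
  have hsm : s = -(2 * (r.natAbs : ℤ)) := by omega
  have hodd : Odd r.natAbs := by
    rw [Int.natAbs_odd, ← Int.not_even_iff_odd, even_iff_two_dvd]
    exact fun ⟨c, hc⟩ => ha4 ⟨c * k ^ 2, by rw [hr, hc]; ring⟩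
  have hsq : Squarefree r.natAbs :=
    Int.squarefree_natAbs.mpr (hs.squarefree_of_dvd ⟨2, by rw [hr]; ring⟩)
  obtain ⟨t, ht, h1, h2⟩ := exists_common_slot hodd hsq hsm hb hd fun p _ hp2 hsq => by
    have := h p hp2 hsq
    push_cast at this
    exact this.of_mul_sq_left
  push_cast
  exact (IsPureSquare.of_common_slot two_ne_zero (by exact_mod_cast hs0.ne)
    (by exact_mod_cast hb.ne) (by exact_mod_cast ht) h1 h2).mul_sq_left (by exact_mod_cast hk)

theorem SplitWhereSquare.symm {a b d : ℤ} (hb : b ≠ 0) (h : SplitWhereSquare a b d) :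
    SplitWhereSquare b a d := fun p _ hp2 hsq =>
  (h p hp2 hsq).symm two_ne_zero_padic (by exact_mod_cast hb)

theorem SplitWhereSquare.neg_mul {a b d : ℤ} (h : SplitWhereSquare a b d) :
    SplitWhereSquare a (-(a * b)) d := fun p _ hp2 hsq => by
  exact_mod_cast (h p hp2 hsq).neg_mul

/-- The generators i + j and k have squares a + b ≡ 2 mod 4 and -ab. -/
theorem isPureSquare_of_modEq {a b d : ℤ} (ha : a < 0) (hb : b < 0) (ha2 : ¬ 2 ∣ a)
    (hab : a % 4 = b % 4) (hd : d = 1 ∨ d = 3) (h : SplitWhereSquare a b d) :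
    IsPureSquare (a : ℚ) b (-d) := by
  have key := isPureSquare_of_two_dvd (a := a + b) (b := -(a * b)) (d := d) (by omega) (by omega)
    (by omega) (by nlinarith) hd fun p _ hp2 hsq => by
      have := (h p hp2 hsq).add_neg_mul two_ne_zero_padic (by exact_mod_cast ha.ne)
        (by exact_mod_cast hb.ne) (by exact_mod_cast (by omega : a + b ≠ 0))
      exact_mod_cast this
  push_cast at key
  exact key.of_add

/-- Replacing j by k turns b into -ab ≡ 1 ≡ a mod 4. -/
theorem isPureSquare_of_odd {a b d : ℤ} (ha : a < 0) (hb : b < 0) (ha2 : a % 4 = 1)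
    (hb2 : b % 4 = 3) (hd : d = 1 ∨ d = 3) (h : SplitWhereSquare a b d) :
    IsPureSquare (a : ℚ) b (-d) := by
  have hab : a * b % 4 = 3 := by rw [Int.mul_emod, ha2, hb2]; rfl
  have key := isPureSquare_of_modEq (a := a) (b := -(a * b)) (d := d) ha (by nlinarith) (by omega)
    (by omega) hd h.neg_mul
  push_cast at key
  exact key.of_neg_mul

theorem isPureSquare_of_squarefree {a b d : ℤ} (ha : a < 0) (hb : b < 0) (hasq : Squarefree a)
    (hbsq : Squarefree b) (hd : d = 1 ∨ d = 3) (h : SplitWhereSquare a b d) :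
    IsPureSquare (a : ℚ) b (-d) := by
  have h4 : ∀ n : ℤ, Squarefree n → ¬ 4 ∣ n := fun n hn ⟨c, hc⟩ =>
    Int.prime_two.not_isUnit (hn 2 ⟨c, by rw [hc]; ring⟩)
  have ha4 := h4 a hasq
  have hb4 := h4 b hbsq
  by_cases ha2 : 2 ∣ a
  · exact isPureSquare_of_two_dvd ha ha2 ha4 hb hd h
  by_cases hb2 : 2 ∣ b
  · exact (isPureSquare_of_two_dvd hb hb2 hb4 ha hd (h.symm hb.ne)).symm
  by_cases hab : a % 4 = b % 4
  · exact isPureSquare_of_modEq ha hb ha2 hab hd h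
  have : a % 4 = 1 ∧ b % 4 = 3 ∨ a % 4 = 3 ∧ b % 4 = 1 := by omega
  rcases this with ⟨h1, h2⟩ | ⟨h1, h2⟩
  · exact isPureSquare_of_odd ha hb h1 h2 hd h
  · exact (isPureSquare_of_odd hb ha h2 h1 hd (h.symm hb.ne)).symm

theorem exists_squarefree_mul_sq_rat {a : ℚ} (ha : a ≠ 0) :
    ∃ (s : ℤ) (k : ℚ), Squarefree s ∧ k ≠ 0 ∧ a = s * k ^ 2 := by
  obtain ⟨s, k, hs, hk, h⟩ := exists_squarefree_mul_sq
    (mul_ne_zero (Rat.num_ne_zero.mpr ha) (by exact_mod_cast a.den_ne_zero) :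
      a.num * (a.den : ℤ) ≠ 0)
  have hden : (a.den : ℚ) ≠ 0 := by exact_mod_cast a.den_ne_zero
  refine ⟨s, k / a.den, hs, div_ne_zero (by exact_mod_cast hk) hden, ?_⟩
  have h' : (a.num : ℚ) * a.den = s * k ^ 2 := by exact_mod_cast h
  nth_rw 1 [← Rat.num_div_den a]
  field_simp
  linear_combination h'

theorem isPureSquare_rat {a b : ℚ} {d : ℤ} (ha : a < 0) (hb : b < 0) (hd : d = 1 ∨ d = 3)
    (h : ∀ (p : ℕ) [Fact p.Prime], p ≠ 2 → IsSquare (-d : ℚ_[p]) → IsNormValue (a : ℚ_[p]) b) :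
    IsPureSquare a b (-d) := by
  obtain ⟨s, k, hs, hk, rfl⟩ := exists_squarefree_mul_sq_rat ha.ne
  obtain ⟨r, l, hr, hl, rfl⟩ := exists_squarefree_mul_sq_rat hb.ne
  have hneg : ∀ (n : ℤ) (e : ℚ), (n : ℚ) * e ^ 2 < 0 → n < 0 := fun n e hne => by
    by_contra hcon
    have : (0 : ℚ) ≤ n := by exact_mod_cast not_lt.mp hcon
    exact absurd (mul_nonneg this (sq_nonneg e)) (not_le.mpr hne)
  have key := isPureSquare_of_squarefree (hneg s k ha) (hneg r l hb) hs hr hd fun p _ hp2 hsq => by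
    have := h p hp2 hsq
    push_cast at this
    exact (this.of_mul_sq (by exact_mod_cast hl)).of_mul_sq_left
  exact ((key.mul_sq_left hk).symm.mul_sq_left hl).symm

end Global

/-! ### Translation to trace and norm, and the congruence conditions. -/

section Main

theorem reducedTrace_eq {F : Type*} [Field F] {a b : F} (x : Quat F a b) :
    reducedTrace x = 2 * x.re := by
  simp [reducedTrace, two_mul]

theorem reducedNorm_eq {F : Type*} [Field F] {a b : F} (x : Quat F a b) :
    reducedNorm x = x.re ^ 2 - (a * x.imI ^ 2 + b * x.imJ ^ 2 - a * b * x.imK ^ 2) := by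
  simp [reducedNorm]
  ring

theorem exists_reducedTrace_eq_zero_iff {a b : ℚ} :
    (∃ x : Quat ℚ a b, reducedTrace x = 0 ∧ reducedNorm x = 1) ↔ IsPureSquare a b (-(1 : ℤ)) := by
  simp only [reducedTrace_eq, reducedNorm_eq]
  constructor
  · rintro ⟨x, h0, h1⟩
    have hre : x.re = 0 := by linarith
    exact ⟨x.imI, x.imJ, x.imK, by rw [hre] at h1; push_cast; linear_combination -h1⟩
  · rintro ⟨x, y, z, h⟩
    exact ⟨⟨0, x, y, z⟩, by simp, by push_cast at h; linear_combination -h⟩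

theorem exists_reducedTrace_eq_one_iff {a b : ℚ} :
    (∃ x : Quat ℚ a b, reducedTrace x = 1 ∧ reducedNorm x = 1) ↔ IsPureSquare a b (-(3 : ℤ)) := by
  simp only [reducedTrace_eq, reducedNorm_eq]
  constructor
  · rintro ⟨x, h0, h1⟩
    have hre : x.re = 1 / 2 := by linarith
    exact ⟨2 * x.imI, 2 * x.imJ, 2 * x.imK, by
      rw [hre] at h1; push_cast; linear_combination -4 * h1⟩
  · rintro ⟨x, y, z, h⟩
    exact ⟨⟨1 / 2, x / 2, y / 2, z / 2⟩, by norm_num, by push_cast at h; linear_combination -h / 4⟩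

theorem IsDefinite.neg {a b : ℚ} (ha : a ≠ 0) (hb : b ≠ 0) (h : IsDefinite a b) :
    a < 0 ∧ b < 0 := by
  have h' := (splitOver_iff_isNormValue (K := ℝ) two_ne_zero ha hb).not.mp h
  simp only [eq_ratCast] at h'
  constructor
  · by_contra hcon
    refine h' (.of_isSquare_left two_ne_zero (by exact_mod_cast ha) ?_ _)
    exact ⟨√a, (Real.mul_self_sqrt (by exact_mod_cast not_lt.mp hcon)).symm⟩
  · by_contra hcon
    refine h' (.of_isSquare_right ?_)
    exact ⟨√b, (Real.mul_self_sqrt (by exact_mod_cast not_lt.mp hcon)).symm⟩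

/-- `-d` is a square of a pure quaternion if and only if it is not a square at any odd prime where
the algebra is ramified. -/
theorem isPureSquare_iff_forall_not_isSquare {a b : ℚ} (ha : a ≠ 0) (hb : b ≠ 0)
    (hdef : IsDefinite a b) {N : ℕ} (hdisc : HasDiscriminant a b N) {d : ℤ} (hd : d = 1 ∨ d = 3) :
    IsPureSquare a b (-d) ↔
      ∀ (p : ℕ) [Fact p.Prime], p ≠ 2 → p ∣ N → ¬ IsSquare ((-d : ℤ) : ℚ_[p]) := by
  have hsplit : ∀ (p : ℕ) [Fact p.Prime], p ∣ N ↔ ¬ IsNormValue (a : ℚ_[p]) (b : ℚ_[p]) := by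
    intro p _
    rw [← hdisc p, RamifiedAt, splitOver_iff_isNormValue two_ne_zero_padic ha hb]
    simp
  have hd0 : d ≠ 0 := by omega
  constructor
  · rintro ⟨x, y, z, h⟩ p _ hp2 hpN ⟨s, hs⟩
    refine (hsplit p).mp hpN (.of_pure_eq_sq two_ne_zero_padic (by exact_mod_cast ha)
      (x := x) (y := y) (z := z) (s := s) ?_ ?_)
    · rintro rfl
      simp [hd0] at hs
    · rw [sq s, ← hs]
      exact_mod_cast h
  · intro h
    obtain ⟨ha', hb'⟩ := hdef.neg ha hb
    refine isPureSquare_rat ha' hb' hd fun p _ hp2 hsq => ?_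
    by_contra hcon
    exact h p hp2 ((hsplit p).mpr hcon) (by exact_mod_cast hsq)

theorem isSquare_neg_one_padic_iff {p : ℕ} [hp : Fact p.Prime] (hp2 : p ≠ 2) :
    IsSquare ((-1 : ℤ) : ℚ_[p]) ↔ p % 4 = 1 := by
  have hodd := Nat.odd_iff.mp (hp.out.odd_of_ne_two hp2)
  have h4 : p % 4 = 1 ↔ IsSquare ((-1 : ℤ) : ZMod p) := by
    push_cast
    rw [ZMod.exists_sq_eq_neg_one_iff]
    omega
  rw [h4]
  refine ⟨isSquare_zmod_of_padic, isSquare_intCast_padic hp2 fun h => ?_⟩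
  exact (Nat.prime_iff_prime_int.mp hp.out).not_isUnit (isUnit_of_dvd_unit h (by simp))

theorem isSquare_neg_three_padic_iff {p : ℕ} [hp : Fact p.Prime] (hp2 : p ≠ 2) :
    IsSquare ((-3 : ℤ) : ℚ_[p]) ↔ p % 3 = 1 := by
  by_cases hp3 : p = 3
  · subst hp3
    -- Although -3 is a square modulo 3, its valuation in ℚ_3 is odd.
    have := not_isSquare_p_mul (p := 3) (n := -1) (by decide)
    norm_num at this ⊢
    exact this
  have h3 : p % 3 = 1 ↔ IsSquare ((-3 : ℤ) : ZMod p) := by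
    rw [isSquare_neg_three_zmod_iff hp2]
    simp [hp3]
  rw [h3]
  refine ⟨isSquare_zmod_of_padic, isSquare_intCast_padic hp2 fun h => ?_⟩
  rw [dvd_neg] at h
  exact hp3 ((Nat.prime_dvd_prime_iff_eq hp.out Nat.prime_three).mp (by exact_mod_cast h))

end Main

end QuatAlg

theorem mainTheorem7 (a b : ℚ) (ha : a ≠ 0) (hb : b ≠ 0) (N : ℕ) (hsq : Squarefree N)
    (hodd : Odd N.primeFactors.card) (hdef : QuatAlg.IsDefinite a b)
    (hdisc : QuatAlg.HasDiscriminant a b N) :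
    ((∃ x : QuatAlg.Quat ℚ a b, QuatAlg.reducedTrace x = 0 ∧ QuatAlg.reducedNorm x = 1) ↔
      ¬ ∃ p : ℕ, p.Prime ∧ p ∣ N ∧ p ≡ 1 [MOD 4]) ∧
    ((∃ x : QuatAlg.Quat ℚ a b, QuatAlg.reducedTrace x = 1 ∧ QuatAlg.reducedNorm x = 1) ↔
      ¬ ∃ p : ℕ, p.Prime ∧ p ∣ N ∧ p ≡ 1 [MOD 3]) := by
  rw [QuatAlg.exists_reducedTrace_eq_zero_iff, QuatAlg.exists_reducedTrace_eq_one_iff,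
    QuatAlg.isPureSquare_iff_forall_not_isSquare ha hb hdef hdisc (.inl rfl),
    QuatAlg.isPureSquare_iff_forall_not_isSquare ha hb hdef hdisc (.inr rfl)]
  constructor
  · constructor
    · rintro h ⟨p, hp, hpN, hp4⟩
      have := Fact.mk hp
      have hp2 : p ≠ 2 := by rintro rfl; exact absurd hp4 (by decide)
      exact h p hp2 hpN ((QuatAlg.isSquare_neg_one_padic_iff hp2).mpr hp4)
    · intro h p hp hp2 hpN hs
      exact h ⟨p, hp.out, hpN, (QuatAlg.isSquare_neg_one_padic_iff hp2).mp hs⟩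
  · constructor
    · rintro h ⟨p, hp, hpN, hp3⟩
      have := Fact.mk hp
      have hp2 : p ≠ 2 := by rintro rfl; exact absurd hp3 (by decide)
      exact h p hp2 hpN ((QuatAlg.isSquare_neg_three_padic_iff hp2).mpr hp3)
    · intro h p hp hp2 hpN hs
      exact h ⟨p, hp.out, hpN, (QuatAlg.isSquare_neg_three_padic_iff hp2).mp hs⟩
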